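/- Let $\mathbb{F}$ be a field and let $n,t$ be integers with $1\le t\le n-1$. A persistence module over $\mathbb{R}^m$ is a functor from the poset $\mathbb{R}^m$ (coordinatewise order) to $\mathbb{F}$-vector spaces. It is cubically encoded if it is isomorphic to $e^*M'$ for a monotone map $e\colon\mathbb{R}^m\to Q$ to a finite poset $Q$, all of whose fibres are finite unions of products of intervals, and a functor $M'$ from $Q$ to finite-dimensional vector spaces; $\mathrm{Mod}_m$ denotes the category of cubically encoded modules. For a measure $\mu$ on the Lebesgue $\sigma$-algebra of $\mathbb{R}^m$ and $1\le p<\infty$, the $L^p$ Hilbert amplitude is $\|M\|_{p,\mu}=\big(\int(\dim M_x)^p\,d\mu(x)\big)^{1/p}\in[0,\infty]$. The path metric $d_{p,\mu}(M,N)$ on the objects of $\mathrm{Mod}_m$ is the infimum, over all zigzags $M\xleftarrow{\gamma_1}C_1\xrightarrow{\gamma_2}\cdots\leftarrow C_k\to N$ in $\mathrm{Mod}_m$, of $\sum_i\big(\|\ker\gamma_i\|_{p,\mu}+\|\operatorname{coker}\gamma_i\|_{p,\mu}\big)$. For $v\in\mathbb{R}^n_{\ge0}$, the interleaving distance $d_{I,v}(M,N)$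 along $v$ is the infimum of all $\varepsilon>0$ for which there are morphisms $\varphi\colon M\to N(\cdot+\varepsilon v)$ and $\psi\colon N\to M(\cdot+\varepsilon v)$ whose two composites are the structure maps $M_x\to M_{x+2\varepsilon v}$ and $N_x\to N_{x+2\varepsilon v}$ for all $x\in\mathbb{R}^n$ ($\infty$ if there is none). Let $\tau$ be a $t$-dimensional face of the positive cone $\mathbb{R}^n_{\ge0}$, i.e. the cone spanned by $t$ of the standard unit vectors, and let $\tau^c$ be the face spanned by the other unit vectors. For a face $\rho$ let $M_\rho$ be the localization, $(M_\rho)_x=\varinjlim_{y\in\rho}M_{x+y}$. Put $H^0_\tau(M)=\ker\big(M\to\prod_{0\ne\rho\subseteq\tau}M_\rho\big)$, the product being over the nonzero faces $\rho$ of $\tau$. For a persistence module $N$ let $N/\tau^c$ be the module over $\mathbb{R}^n/\mathbb{R}\tau^c\cong\mathbb{R}^t$ (the coordinates of $\tau$) given by $(N/\tau^c)_{x+\mathbb{R}\tau^c}=\varinjlim_{y\in x+\tau^c}N_y$. The $c_\tau$-rank of $M\in\mathrm{Mod}_n$ is $c_\tau(M)=\|H^0_\tau(M)/\tau^c\|_{1,\lambda}\in[0,\infty]$,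 with $\lambda$ Lebesgue measure on $\mathbb{R}^t$. Then, as a function from the extended pseudometric space $(\operatorname{ob}\mathrm{Mod}_n,d)$ to $[0,\infty]$: 1. $c_\tau$ is not continuous for $d=d_{I,v}$, for any vector $v$ all of whose coordinates are positive (in particular for any diagonal vector $v=(a,\dots,a)$, $a>0$). 2. $c_\tau$ is not continuous for $d=d_{p,\mu}$, for any finite nonzero measure $\mu$ on the Lebesgue $\sigma$-algebra of $\mathbb{R}^n$ and any $1\le p<\infty$. 3. For $d=d_{p,\lambda}$ with $\lambda$ Lebesgue measure on $\mathbb{R}^n$ and $1\le p<\infty$, $c_\tau$ is $K$-Lipschitz for every real $K>0$. Here continuity refers to the usual topology of $[0,\infty]$, and the Lipschitz condition to the distance $|a-b|$ on $[0,\infty]$ with $|\infty-\infty|=0$ and $|\infty-a|=\infty$ for $a<\infty$. -/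

import Mathlib

open CategoryTheory MeasureTheory
open scoped NNReal ENNReal

namespace CtauRank

noncomputable section

universe u v w

/-! ### Path metrics on full subcategories of an abelian category -/

section PathMetric

variable {C : Type v} [Category.{w} C] [Abelian C]

/-- The cost `α (ker f) + α (coker f)` of a morphism. -/
def morphismCost (α : C → ℝ≥0∞) {A B : C} (f : A ⟶ B) : ℝ≥0∞ :=
  α (Limits.kernel f) + α (Limits.cokernel f)

/-- Zigzags `A ← C₁ → ⋯ ← Cₙ → B` of morphisms between objects of the full subcategory of `C`
cut out by `P`. -/
inductive Zigzag (P : ObjectProperty C) :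
    P.FullSubcategory → P.FullSubcategory → Type (max v w)
  | span {A B : P.FullSubcategory} (X : P.FullSubcategory)
      (f : X.obj ⟶ A.obj) (g : X.obj ⟶ B.obj) : Zigzag P A B
  | cons {A D B : P.FullSubcategory} (X : P.FullSubcategory)
      (f : X.obj ⟶ A.obj) (g : X.obj ⟶ D.obj) (z : Zigzag P D B) : Zigzag P A B

variable {P : ObjectProperty C}

/-- The cost of a zigzag is the sum of the costs of its morphisms. -/
def Zigzag.cost (α : C → ℝ≥0∞) : {A B : P.FullSubcategory} → Zigzag P A B → ℝ≥0∞
  | _, _, .span _ f g => morphismCost α f + morphismCost α g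
  | _, _, .cons _ f g z => morphismCost α f + morphismCost α g + z.cost α

/-- Juxtaposition of zigzags. -/
def Zigzag.append : {A B D : P.FullSubcategory} → Zigzag P A B → Zigzag P B D → Zigzag P A D
  | _, _, _, .span X f g, z' => .cons X f g z'
  | _, _, _, .cons X f g z, z' => .cons X f g (z.append z')

theorem Zigzag.cost_append (α : C → ℝ≥0∞) {A B D : P.FullSubcategory}
    (z : Zigzag P A B) (z' : Zigzag P B D) : (z.append z').cost α = z.cost α + z'.cost α := by
  induction z with
  | span X f g => rfl
  | cons X f g z ih => simp only [Zigzag.append, Zigzag.cost, ih, add_assoc]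

/-- The reverse of a zigzag. -/
def Zigzag.reverse : {A B : P.FullSubcategory} → Zigzag P A B → Zigzag P B A
  | _, _, .span X f g => .span X g f
  | _, _, .cons X f g z => z.reverse.append (.span X g f)

theorem Zigzag.cost_reverse (α : C → ℝ≥0∞) {A B : P.FullSubcategory}
    (z : Zigzag P A B) : z.reverse.cost α = z.cost α := by
  induction z with
  | span X f g => simp only [Zigzag.reverse, Zigzag.cost, add_comm]
  | cons X f g z ih =>
    simp only [Zigzag.reverse, Zigzag.cost_append, Zigzag.cost, ih]
    ring

/-- The infimum of the costs of all zigzags from `A` to `B` (it is `∞` if there are none). -/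
def pathDist (P : ObjectProperty C) (α : C → ℝ≥0∞) (A B : P.FullSubcategory) : ℝ≥0∞ :=
  ⨅ z : Zigzag P A B, z.cost α

/-- The path metric, as an extended pseudometric on the objects of the full subcategory. -/
@[reducible]
def pathMetric (P : ObjectProperty C) (α : C → ℝ≥0∞)
    (hα : ∀ X : C, Limits.IsZero X → α X = 0) : PseudoEMetricSpace P.FullSubcategory where
  edist := pathDist P α
  edist_self A := by
    have h : morphismCost α (𝟙 A.obj) = 0 := by
      rw [morphismCost, hα _ (Limits.isZero_kernel_of_mono _),
        hα _ (Limits.isZero_cokernel_of_epi _), add_zero]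
    refine le_antisymm (iInf_le_of_le (.span A (𝟙 _) (𝟙 _)) ?_) zero_le
    simp only [Zigzag.cost, h, add_zero, le_refl]
  edist_comm A B := by
    apply le_antisymm
    · exact le_iInf fun z => iInf_le_of_le z.reverse (z.cost_reverse α).le
    · exact le_iInf fun z => iInf_le_of_le z.reverse (z.cost_reverse α).le
  edist_triangle A B D := by
    simp only [pathDist]
    rw [ENNReal.iInf_add]
    refine le_iInf fun z => ?_
    rw [ENNReal.add_iInf]
    exact le_iInf fun z' => iInf_le_of_le (z.append z') (Zigzag.cost_append α z z').le

end PathMetric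

/-! ### Cubically encoded persistence modules -/

section PersistenceModules

variable {F : Type u} [Field F] {ι : Type}

/-- `ℝ^ι` is regarded as the category of the poset `ℝ^ι` with the coordinatewise order. -/
instance posetCategory (ι : Type) : SmallCategory (ι → ℝ) := Preorder.smallCategory (ι → ℝ)

/-- Persistence modules over `ℝ^ι` with the coordinatewise order, with values in vector spaces. -/
abbrev PModule (F : Type u) [Field F] (ι : Type) : Type (u + 1) := (ι → ℝ) ⥤ ModuleCat.{u} F

/-- A cube is a product of (open, closed, half-open, possibly unbounded) intervals of `ℝ`. -/
def IsCube (s : Set (ι → ℝ)) : Prop :=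
  ∃ I : ι → Set ℝ, (∀ i, (I i).OrdConnected) ∧ s = Set.univ.pi I

/-- The algebra of cubes: finite unions of cubes. -/
def IsCubical (s : Set (ι → ℝ)) : Prop :=
  ∃ 𝒮 : Set (Set (ι → ℝ)), 𝒮.Finite ∧ (∀ Q ∈ 𝒮, IsCube Q) ∧ s = ⋃₀ 𝒮

/-- `M` is isomorphic to the pullback of a pointwise finite dimensional module over a finite poset
along a monotone map all of whose fibres are finite unions of cubes. -/
def IsCubicallyEncoded (F : Type u) [Field F] (ι : Type) : ObjectProperty (PModule F ι) :=
  fun M => ∃ (Q : Type) (_ : PartialOrder Q) (_ : Finite Q) (e : (ι → ℝ) →o Q)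
    (M' : Q ⥤ ModuleCat.{u} F), (∀ q, Module.Finite F (M'.obj q)) ∧
      (∀ q, IsCubical (e ⁻¹' {q})) ∧ Nonempty (M ≅ e.monotone.functor ⋙ M')

/-- Cubically encoded persistence modules over `ℝ^ι`. -/
abbrev CubMod (F : Type u) [Field F] (ι : Type) : Type (u + 1) :=
  (IsCubicallyEncoded F ι).FullSubcategory

/-! ### Hilbert amplitudes -/

/-- `ℝ^ι` equipped with the `σ`-algebra of Lebesgue measurable sets. -/
abbrev LebesgueSpace (ι : Type) [Fintype ι] : Type :=
  NullMeasurableSpace (ι → ℝ) (volume : Measure (ι → ℝ))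

/-- Lebesgue measure on the Lebesgue `σ`-algebra. -/
def lebesgue (ι : Type) [Fintype ι] : Measure (LebesgueSpace ι) :=
  (volume : Measure (ι → ℝ)).completion

/-- The Hilbert function `x ↦ dim M_x`. -/
def hilbertFunction (M : PModule F ι) (x : ι → ℝ) : ℝ≥0∞ :=
  ((Module.rank F (M.obj x)).toENat : ℝ≥0∞)

/-- The `L^p` Hilbert amplitude `(∫ (dim M_x)^p dμ(x))^(1/p)`. -/
def hilbertAmplitude [Fintype ι] (p : ℝ) (μ : Measure (LebesgueSpace ι)) (M : PModule F ι) : ℝ≥0∞ :=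
  (∫⁻ x : LebesgueSpace ι, hilbertFunction M x ^ p ∂μ) ^ (1 / p)

theorem hilbertAmplitude_of_isZero [Fintype ι] {p : ℝ} (hp : 1 ≤ p) (μ : Measure (LebesgueSpace ι))
    (M : PModule F ι) (hM : Limits.IsZero M) : hilbertAmplitude p μ M = 0 := by
  have h : hilbertFunction M = fun _ => 0 := by
    funext x
    have := ModuleCat.subsingleton_of_isZero (hM.obj x)
    simp [hilbertFunction]
  have hp0 : 0 < p := by linarith
  simp [hilbertAmplitude, h, hp0]

/-- The path metric on cubically encoded modules induced by the `L^p` Hilbert amplitude. -/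
@[reducible]
def hilbertPathMetric [Fintype ι] (F : Type u) [Field F] (p : ℝ) (hp : 1 ≤ p)
    (μ : Measure (LebesgueSpace ι)) : PseudoEMetricSpace (CubMod F ι) :=
  pathMetric (IsCubicallyEncoded F ι) (hilbertAmplitude p μ) (hilbertAmplitude_of_isZero hp μ)

/-! ### Interleaving distances -/

/-- The vector `ε v`, for `ε ≥ 0` and `v` in the positive cone. -/
def scaled (ε : ℝ≥0) (v : ι → ℝ≥0) : ι → ℝ := fun i => ((ε * v i : ℝ≥0) : ℝ)

theorem le_add_scaled (ε : ℝ≥0) (v : ι → ℝ≥0) (x : ι → ℝ) : x ≤ x + scaled ε v :=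
  fun i => le_add_of_nonneg_right (ε * v i).2

theorem map_map (M : PModule F ι) {x y z : ι → ℝ} (h : x ≤ y) (h' : y ≤ z) :
    M.map (homOfLE h) ≫ M.map (homOfLE h') = M.map (homOfLE (h.trans h')) :=
  (M.map_comp _ _).symm

/-- The shift `M^{+w}`, with `(M^{+w})_x = M_{x + w}`. -/
abbrev shift (w : ι → ℝ) (M : PModule F ι) : PModule F ι where
  obj x := M.obj (x + w)
  map h := M.map (homOfLE (add_le_add_left (leOfHom h) w))
  map_id x := M.map_id (x + w)
  map_comp _ _ := (map_map M _ _).symm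

theorem shift_naturality {w : ι → ℝ} {A B : PModule F ι} (φ : A ⟶ shift w B) {x y : ι → ℝ}
    (h : x ≤ y) (h' : x + w ≤ y + w) :
    A.map (homOfLE h) ≫ φ.app y = (φ.app x ≫ B.map (homOfLE h') : A.obj x ⟶ B.obj (y + w)) :=
  φ.naturality (homOfLE h)

/-- There is an `ε`-interleaving between `A` and `B` along `v`. -/
def IsInterleaved (v : ι → ℝ≥0) (ε : ℝ≥0) (A B : PModule F ι) : Prop :=
  ∃ (φ : A ⟶ shift (scaled ε v) B) (ψ : B ⟶ shift (scaled ε v) A),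
    (∀ x : ι → ℝ, φ.app x ≫ ψ.app (x + scaled ε v) =
      A.map (homOfLE ((le_add_scaled ε v x).trans (le_add_scaled ε v _)))) ∧
    (∀ x : ι → ℝ, ψ.app x ≫ φ.app (x + scaled ε v) =
      B.map (homOfLE ((le_add_scaled ε v x).trans (le_add_scaled ε v _))))

theorem IsInterleaved.refl (v : ι → ℝ≥0) (ε : ℝ≥0) (A : PModule F ι) :
    IsInterleaved v ε A A := by
  let η : A ⟶ shift (scaled ε v) A :=
    { app := fun x => A.map (homOfLE (le_add_scaled ε v x))
      naturality := fun x y f =>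
        (map_map A (leOfHom f) (le_add_scaled ε v y)).trans
          (map_map A (le_add_scaled ε v x) (add_le_add_left (leOfHom f) _)).symm }
  exact ⟨η, η, fun x => map_map A _ _, fun x => map_map A _ _⟩

theorem IsInterleaved.symm {v : ι → ℝ≥0} {ε : ℝ≥0} {A B : PModule F ι}
    (h : IsInterleaved v ε A B) : IsInterleaved v ε B A := by
  obtain ⟨φ, ψ, h₁, h₂⟩ := h
  exact ⟨ψ, φ, h₂, h₁⟩

theorem scaled_add (ε δ : ℝ≥0) (v : ι → ℝ≥0) (x : ι → ℝ) :
    x + scaled ε v + scaled δ v = x + scaled (ε + δ) v := by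
  funext i
  simp only [scaled, Pi.add_apply]
  push_cast
  ring

theorem comp_naturality_aux {C : Type v} [Category.{w} C] {X X' Y Y' Z Z' W W' : C}
    {a : X ⟶ X'} {f' : X' ⟶ Y'} {g' : Y' ⟶ Z'} {d' : Z' ⟶ W'} {f : X ⟶ Y} {b : Y ⟶ Y'}
    {g : Y ⟶ Z} {c : Z ⟶ Z'} {d : Z ⟶ W} {e : W ⟶ W'} (h₁ : a ≫ f' = f ≫ b)
    (h₂ : b ≫ g' = g ≫ c) (h₃ : c ≫ d' = d ≫ e) :
    a ≫ f' ≫ g' ≫ d' = (f ≫ g ≫ d) ≫ e := by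
  rw [← Category.assoc, h₁, Category.assoc, ← Category.assoc b, h₂, Category.assoc, h₃]
  simp only [Category.assoc]

/-- The composite `A → B^{+a} → D^{+c}` of two shifted morphisms, for `c = a + b`. -/
def shiftComp {a b c : ι → ℝ} (hc : ∀ x : ι → ℝ, x + a + b = x + c) {A B D : PModule F ι}
    (φ : A ⟶ shift a B) (φ' : B ⟶ shift b D) : A ⟶ shift c D where
  app x := (φ.app x ≫ φ'.app (x + a) ≫ D.map (homOfLE (hc x).le) : A.obj x ⟶ D.obj (x + c))
  naturality x y f :=
    have h := leOfHom f
    have h₁ : x + a ≤ y + a := add_le_add_left h a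
    have h₂ : x + a + b ≤ y + a + b := add_le_add_left h₁ b
    have h₃ : x + c ≤ y + c := add_le_add_left h c
    comp_naturality_aux (shift_naturality φ h h₁) (shift_naturality φ' h₁ h₂)
      ((map_map D h₂ (hc y).le).trans (map_map D (hc x).le h₃).symm)

theorem comp_interleaving_aux {C : Type v} [Category.{w} C] {A₀ B₁ D₂ D₃ B₃ B₄ A₂ A₅ A₆ : C}
    {f : A₀ ⟶ B₁} {g : B₁ ⟶ D₂} {d : D₂ ⟶ D₃} {g' : D₃ ⟶ B₄} {f' : B₄ ⟶ A₅} {a : A₅ ⟶ A₆}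
    {k : D₂ ⟶ B₃} {b : B₃ ⟶ B₄} {b' : B₁ ⟶ B₃} {b'' : B₁ ⟶ B₄} {f'' : B₁ ⟶ A₂} {a' : A₂ ⟶ A₅}
    {a'' : A₀ ⟶ A₂} {r : A₀ ⟶ A₆} (h₁ : d ≫ g' = k ≫ b) (h₂ : g ≫ k = b') (h₃ : b' ≫ b = b'')
    (h₄ : b'' ≫ f' = f'' ≫ a') (h₅ : f ≫ f'' = a'') (h₆ : (a'' ≫ a') ≫ a = r) :
    (f ≫ g ≫ d) ≫ g' ≫ f' ≫ a = r := by
  subst h₂ h₃ h₅ h₆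
  simp only [Category.assoc] at h₄ ⊢
  rw [← Category.assoc d, h₁]
  simp only [Category.assoc]
  rw [← Category.assoc b, ← Category.assoc k, ← Category.assoc g]
  simp only [Category.assoc]
  rw [reassoc_of% h₄]

theorem shiftComp_comp {a b c : ι → ℝ} (ha : ∀ x : ι → ℝ, x ≤ x + a) (hb : ∀ x : ι → ℝ, x ≤ x + b)
    (hc : ∀ x : ι → ℝ, x ≤ x + c) (hab : ∀ x : ι → ℝ, x + a + b = x + c)
    (hba : ∀ x : ι → ℝ, x + b + a = x + c) {A B D : PModule F ι}
    (φ : A ⟶ shift a B) (ψ : B ⟶ shift a A) (φ' : B ⟶ shift b D) (ψ' : D ⟶ shift b B)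
    (h : ∀ x : ι → ℝ, φ.app x ≫ ψ.app (x + a) = A.map (homOfLE ((ha x).trans (ha _))))
    (h' : ∀ x : ι → ℝ, φ'.app x ≫ ψ'.app (x + b) = B.map (homOfLE ((hb x).trans (hb _))))
    (x : ι → ℝ) :
    (shiftComp hab φ φ').app x ≫ (shiftComp hba ψ' ψ).app (x + c) =
      A.map (homOfLE ((hc x).trans (hc _))) :=
  have l₁ : x + a + b + b ≤ x + c + b := add_le_add_left (hab x).le b
  have l₂ : x + a ≤ x + c + b := ((hb _).trans (hb _)).trans l₁
  have l₃ : x + a + a ≤ x + c + b + a := add_le_add_left l₂ a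
  comp_interleaving_aux (shift_naturality ψ' (hab x).le l₁) (h' (x + a)) (map_map B _ l₁)
    (shift_naturality ψ l₂ l₃) (h x)
    ((congrArg (fun m => m ≫ A.map (homOfLE (hba (x + c)).le)) (map_map A _ l₃)).trans
      (map_map A _ _))

theorem IsInterleaved.trans {v : ι → ℝ≥0} {ε δ : ℝ≥0} {A B D : PModule F ι}
    (h : IsInterleaved v ε A B) (h' : IsInterleaved v δ B D) :
    IsInterleaved v (ε + δ) A D := by
  obtain ⟨φ, ψ, h₁, h₂⟩ := h
  obtain ⟨φ', ψ', h₁', h₂'⟩ := h'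
  have e : ∀ x : ι → ℝ, x + scaled δ v + scaled ε v = x + scaled (ε + δ) v := fun x => by
    rw [scaled_add, add_comm δ ε]
  exact ⟨shiftComp (scaled_add ε δ v) φ φ', shiftComp e ψ' ψ,
    shiftComp_comp (le_add_scaled ε v) (le_add_scaled δ v) (le_add_scaled _ v) _ _ φ ψ φ' ψ' h₁ h₁',
    shiftComp_comp (le_add_scaled δ v) (le_add_scaled ε v) (le_add_scaled _ v) _ _ ψ' φ' ψ φ
      h₂' h₂⟩

/-- The interleaving distance along `v`: the infimum of all `ε > 0` for which there is an
`ε`-interleaving (it is `∞` if there is none). -/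
def interleavingDist (v : ι → ℝ≥0) (A B : CubMod F ι) : ℝ≥0∞ :=
  ⨅ (ε : ℝ≥0) (_ : 0 < ε ∧ IsInterleaved v ε A.obj B.obj), (ε : ℝ≥0∞)

/-- The interleaving distance along `v`, as an extended pseudometric on cubically encoded
modules. -/
@[reducible]
def interleavingMetric (F : Type u) [Field F] (v : ι → ℝ≥0) :
    PseudoEMetricSpace (CubMod F ι) where
  edist := interleavingDist v
  edist_self A := by
    refine le_antisymm (ENNReal.le_of_forall_pos_le_add fun ε hε _ => ?_) zero_le
    rw [zero_add]
    exact iInf₂_le ε ⟨hε, IsInterleaved.refl v ε A.obj⟩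
  edist_comm A B := by
    apply le_antisymm
    · exact le_iInf₂ fun ε h => iInf₂_le ε ⟨h.1, h.2.symm⟩
    · exact le_iInf₂ fun ε h => iInf₂_le ε ⟨h.1, h.2.symm⟩
  edist_triangle A B D := by
    simp only [interleavingDist, ENNReal.iInf_add, ENNReal.add_iInf]
    refine le_iInf₂ fun ε h => le_iInf₂ fun δ h' => ?_
    exact iInf₂_le_of_le (δ + ε) ⟨add_pos h'.1 h.1, h'.2.trans h.2⟩
      (by rw [ENNReal.coe_add, add_comm])

/-! ### Localization, local cohomology, quotient restriction and the `c_τ`-rank -/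

/-- The face of the positive cone of `ℝ^ι` spanned by the unit vectors `e_i`, `i ∈ T`. -/
def face (T : Finset ι) : Set (ι → ℝ) := {x | (∀ i, 0 ≤ x i) ∧ ∀ i, i ∉ T → x i = 0}

/-- The diagram `y ↦ M_{x + y}`, for `y` in the face spanned by `T`. -/
abbrev faceDiagram (T : Finset ι) (M : PModule F ι) (x : ι → ℝ) : face T ⥤ ModuleCat.{u} F where
  obj y := M.obj (x + y.1)
  map {y y'} h := M.map (homOfLE (add_le_add_right (show y.1 ≤ y'.1 from leOfHom h) x))
  map_id y := M.map_id (x + y.1)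
  map_comp _ _ := (map_map M _ _).symm

/-- The map of diagrams `M_{x + y} → M_{x' + y}` for `x ≤ x'`. -/
def faceDiagramMap (T : Finset ι) (M : PModule F ι) {x x' : ι → ℝ} (h : x ⟶ x') :
    faceDiagram T M x ⟶ faceDiagram T M x' where
  app y := M.map (homOfLE (add_le_add_left (leOfHom h) y.1))
  naturality _ _ _ := (map_map M _ _).trans (map_map M _ _).symm

/-- The localization of `M` at the face `ρ` spanned by `T`: the module obtained by inverting the
monomials `x^y` for `y ∈ ρ`, that is, `(M_ρ)_x = colim_{y ∈ ρ} M_{x + y}`. -/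
def localization (T : Finset ι) (M : PModule F ι) : PModule F ι where
  obj x := Limits.colimit (faceDiagram T M x)
  map h := Limits.colimMap (faceDiagramMap T M h)
  map_id x := by
    refine Limits.colimit.hom_ext fun y => ?_
    rw [Limits.ι_colimMap, Category.comp_id]
    change M.map (𝟙 (x + y.1)) ≫ _ = _
    rw [M.map_id]
    exact Category.id_comp _
  map_comp {x x' x''} h h' := by
    refine Limits.colimit.hom_ext fun y => ?_
    rw [Limits.ι_colimMap, Limits.ι_colimMap_assoc, Limits.ι_colimMap, ← Category.assoc]
    congr 1
    exact M.map_comp _ _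

/-- The origin, as an element of a face. -/
def faceZero (T : Finset ι) : face T := ⟨0, fun _ => le_rfl, fun _ _ => rfl⟩

theorem toLocalization_naturality_aux {C : Type v} [Category.{w} C] {A B A' B' L L' : C}
    {m : A ⟶ A'} {i : A' ⟶ L} {m' : B ⟶ B'} {i' : B' ⟶ L'} {a : A ⟶ B} {a' : A' ⟶ B'} {l : L ⟶ L'}
    (h : a ≫ m' = m ≫ a') (h' : i ≫ l = a' ≫ i') : a ≫ m' ≫ i' = (m ≫ i) ≫ l := by
  rw [← Category.assoc, h, Category.assoc, Category.assoc, h']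

/-- The canonical map `M → M_ρ`, where `ρ` is the face spanned by `T`. -/
def toLocalization (T : Finset ι) (M : PModule F ι) : M ⟶ localization T M where
  app x := M.map (homOfLE (show x ≤ x + (faceZero T).1 from (add_zero x).ge)) ≫
    Limits.colimit.ι (faceDiagram T M x) (faceZero T)
  naturality _ _ h := toLocalization_naturality_aux
    ((map_map M _ _).trans (map_map M _ _).symm) (Limits.ι_colimMap (faceDiagramMap T M h) _)

/-- The `0`-th local cohomology `H⁰_τ(M) = ker (M → ∏_{0 ≠ ρ ⊆ τ} M_ρ)`, where `τ` is the face
spanned by `S` and `ρ` runs through the nontrivial faces of `τ`. -/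
def zerothLocalCohomology (S : Finset ι) (M : PModule F ι) : PModule F ι :=
  Limits.kernel (Limits.Pi.lift fun T : {T : Finset ι // T.Nonempty ∧ T ⊆ S} =>
    toLocalization T.1 M)

/-- Extension by zero `ℝ^(ι ∖ T) → ℝ^ι`. It gives representatives of the classes in `ℝ^ι / ℝτ`,
where `τ` is the face spanned by `T`, and identifies `ℝ^ι / ℝτ` with `ℝ^(ι ∖ T)`. -/
def extendZero [DecidableEq ι] (T : Finset ι) (x : {i // i ∉ T} → ℝ) : ι → ℝ :=
  fun i => if h : i ∉ T then x ⟨i, h⟩ else 0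

theorem extendZero_mono [DecidableEq ι] (T : Finset ι) : Monotone (extendZero T) := by
  intro x y h i
  unfold extendZero
  split
  · exact h _
  · exact le_rfl

/-- The quotient restriction `M / τ` along the face `τ` spanned by `T`, with
`(M / τ)_{x + ℝτ} = colim_{y ∈ x + τ} M_y`, as a module over `ℝ^ι / ℝτ = ℝ^(ι ∖ T)`. -/
def quotientRestriction [DecidableEq ι] (T : Finset ι) (M : PModule F ι) :
    PModule F {i // i ∉ T} :=
  (extendZero_mono T).functor ⋙ localization T M

/-- The `c_τ`-rank, where `τ` is the face of the positive cone of `ℝ^ι` spanned by `S`: the `L¹`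
Hilbert amplitude of `H⁰_τ(M) / τᶜ`, with respect to Lebesgue measure. -/
def cRank [Fintype ι] [DecidableEq ι] (S : Finset ι) (M : CubMod F ι) : ℝ≥0∞ :=
  hilbertAmplitude 1 (lebesgue _) (quotientRestriction Sᶜ (zerothLocalCohomology S M.obj))

end PersistenceModules

end

end CtauRank

open CategoryTheory MeasureTheory CtauRank
open scoped NNReal ENNReal

namespace CtauRank

noncomputable section

universe u

variable {F : Type u} [Field F] {ι : Type}

/-! ### Elements of localizations and of local cohomology -/

/-! Lipschitz part: a zigzag of finite cost forces equality of $c_\tau$, so modules with different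
ranks are at infinite distance and every $K>0$ works. Cut $\mathbb{R}^n$ into finitely many cubes on
which all structure maps of source and target of a morphism γ are isomorphisms. If γ is not
injective (or not surjective) on a cube, the kernel (or cokernel) has dimension at least 1 there, so
finite cost makes the cube's volume finite; the cube then lies in a hyperplane or is bounded above
in every coordinate. Hence γ is bijective at all points whose coordinates avoid a finite set `D` and
of which one coordinate exceeds some `R` (`exists_isGeneric_bijective`). Such points are cofinal
along every nonzero face. Vanishing in $M_\rho$ and the colimit along $\tau^c$, nonzero because
$t<n$, are both decided there, so the Hilbert functions of $H^0_\tau/\tau^c$ agree almost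
everywhere.

Discontinuity: the module with value $V$ on $[0,a)^t\times[R,\infty)^{n-t}$ is its own $H^0_\tau$,
and its rank is at least $a^t\dim V$, for every `R` (`le_cRank_boxModule`). Thin boxes with large
$V$ are close to zero for interleavings; boxes with $a=1$, $\dim V=1$ and $R\to\infty$ are close to
zero for a finite measure. In both cases the rank stays at least 1, while the zero module has rank
0. -/

instance faceIsFiltered (T : Finset ι) : IsFiltered (face T) := by
  have : Nonempty (face T) := ⟨faceZero T⟩
  have : IsDirectedOrder (face T) := ⟨fun a b => ⟨⟨a.1 ⊔ b.1,
    fun i => le_sup_of_le_left (a.2.1 i),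
    fun i hi => by simp [a.2.2 i hi, b.2.2 i hi]⟩,
    Subtype.coe_le_coe.1 le_sup_left, Subtype.coe_le_coe.1 le_sup_right⟩⟩
  exact isFiltered_of_directed_le_nonempty _

/-- Faces live in `Type` and modules in universe `u`; this allows colimits over faces to be computed
on elements. -/
instance forget_preservesFilteredColimits_small :
    Limits.PreservesFilteredColimitsOfSize.{0, 0} (forget (ModuleCat.{u} F)) :=
  Limits.preservesSmallestFilteredColimits_of_preservesFilteredColimits.{u, u} _

theorem le_add_of_mem_face {T : Finset ι} {y : ι → ℝ} (hy : y ∈ face T) (x : ι → ℝ) :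
    x ≤ x + y :=
  fun i => le_add_of_nonneg_right (hy.1 i)

theorem map_map_apply (M : PModule F ι) {x y z : ι → ℝ} (h : x ≤ y) (h' : y ≤ z) (m : M.obj x) :
    M.map (homOfLE h') (M.map (homOfLE h) m) = M.map (homOfLE (h.trans h')) m := by
  rw [← map_map M h h']; rfl

theorem naturality_map_apply {M N : PModule F ι} (γ : M ⟶ N) {x y : ι → ℝ} (h : x ≤ y)
    (m : M.obj x) : γ.app y (M.map (homOfLE h) m) = N.map (homOfLE h) (γ.app x m) :=
  congrArg (fun f : M.obj x ⟶ N.obj y => f m) (γ.naturality (homOfLE h))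

theorem colimit_ι_eq_zero_iff (T : Finset ι) (M : PModule F ι) (x : ι → ℝ) (y : face T)
    (m : M.obj (x + y.1)) :
    Limits.colimit.ι (faceDiagram T M x) y m = 0 ↔
      ∃ (y' : face T) (h : x + y.1 ≤ x + y'.1), M.map (homOfLE h) m = 0 := by
  constructor
  · intro hm
    have h0 : Limits.colimit.ι (faceDiagram T M x) y m =
        Limits.colimit.ι (faceDiagram T M x) y (0 : M.obj (x + y.1)) := by
      rw [hm]; exact (map_zero (Limits.colimit.ι (faceDiagram T M x) y).hom).symm
    obtain ⟨k, f, g, hfg⟩ := (Limits.Concrete.colimit_rep_eq_iff_exists _ _ _).1 h0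
    refine ⟨k, add_le_add_right (show y.1 ≤ k.1 from leOfHom f) x, hfg.trans ?_⟩
    exact map_zero ((faceDiagram T M x).map g).hom
  · rintro ⟨y', h, hm⟩
    have hy : y ≤ y' := Subtype.coe_le_coe.1 (le_of_add_le_add_left h)
    have := congrArg (fun f : (faceDiagram T M x).obj y ⟶ _ => f m)
      (Limits.colimit.w (faceDiagram T M x) (homOfLE hy))
    refine this.symm.trans ?_
    change Limits.colimit.ι (faceDiagram T M x) y' (M.map (homOfLE h) m) = 0
    rw [hm]
    exact map_zero (Limits.colimit.ι (faceDiagram T M x) y').hom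

theorem toLocalization_app_eq_zero_iff (T : Finset ι) (M : PModule F ι) (x : ι → ℝ)
    (m : M.obj x) :
    (toLocalization T M).app x m = 0 ↔
      ∃ (y : ι → ℝ) (hy : y ∈ face T), M.map (homOfLE (le_add_of_mem_face hy x)) m = 0 := by
  have h0 : x ≤ x + (faceZero T).1 := (add_zero x).ge
  change Limits.colimit.ι (faceDiagram T M x) (faceZero T) (M.map (homOfLE h0) m) = 0 ↔ _
  rw [colimit_ι_eq_zero_iff]
  constructor
  · rintro ⟨y, h, hm⟩
    exact ⟨y.1, y.2, by rwa [map_map_apply] at hm⟩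
  · rintro ⟨y, hy, hm⟩
    refine ⟨⟨y, hy⟩, add_le_add_right (show (faceZero T).1 ≤ y from hy.1) x, ?_⟩
    rwa [map_map_apply]

/-- The inclusion of the `0`-th local cohomology. -/
def zerothLocalCohomologyι (S : Finset ι) (M : PModule F ι) : zerothLocalCohomology S M ⟶ M :=
  Limits.kernel.ι _

instance (S : Finset ι) (M : PModule F ι) : Mono (zerothLocalCohomologyι S M) :=
  Limits.equalizer.ι_mono

theorem zerothLocalCohomologyι_app_injective (S : Finset ι) (M : PModule F ι) (x : ι → ℝ) :
    Function.Injective ((zerothLocalCohomologyι S M).app x) :=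
  (ModuleCat.mono_iff_injective _).1 inferInstance

/-- Evaluation at a point preserves products, so an element of a product of modules is determined by
its coordinates. -/
theorem piLift_app_eq_zero {J : Type} {M : PModule F ι} {N : J → PModule F ι}
    (f : ∀ j, M ⟶ N j) {x : ι → ℝ} {m : M.obj x} (h : ∀ j, (f j).app x m = 0) :
    (Limits.Pi.lift f).app x m = 0 := by
  refine Limits.Concrete.isLimit_ext _ (Limits.isLimitOfPreserves ((evaluation _ _).obj x)
    (Limits.limit.isLimit (Discrete.functor N))) _ _ fun j => ?_
  have h₁ : ((Limits.Pi.π N j.as).app x) ((Limits.Pi.lift f).app x m) = (f j.as).app x m :=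
    congrArg (fun g : M ⟶ N j.as => g.app x m) (Limits.Pi.lift_π f j.as)
  exact (h₁.trans (h _)).trans (map_zero ((Limits.Pi.π N j.as).app x).hom).symm

/-- This elementwise criterion, torsion along each nonzero face of τ, replaces the categorical
kernel in all later arguments. -/
theorem mem_range_zerothLocalCohomologyι (S : Finset ι) (M : PModule F ι) (x : ι → ℝ)
    (m : M.obj x) :
    (∃ h, (zerothLocalCohomologyι S M).app x h = m) ↔
      ∀ T : Finset ι, T.Nonempty → T ⊆ S →
        ∃ (y : ι → ℝ) (hy : y ∈ face T), M.map (homOfLE (le_add_of_mem_face hy x)) m = 0 := by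
  let f := Limits.Pi.lift fun T : {T : Finset ι // T.Nonempty ∧ T ⊆ S} => toLocalization T.1 M
  have hw : zerothLocalCohomologyι S M ≫ f = 0 := Limits.kernel.condition f
  constructor
  · rintro ⟨h, rfl⟩ T hT hTS
    rw [← toLocalization_app_eq_zero_iff]
    have hf : f ≫ Limits.Pi.π _ ⟨T, hT, hTS⟩ = toLocalization T M := Limits.Pi.lift_π _ _
    have : zerothLocalCohomologyι S M ≫ toLocalization T M = 0 := by
      rw [← hf, ← Category.assoc, hw, Limits.zero_comp]
    exact congrArg (fun g : zerothLocalCohomology S M ⟶ _ => g.app x h) this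
  · intro hm
    have hex : (ShortComplex.mk _ _ hw).Exact :=
      ShortComplex.exact_of_f_is_kernel _ (Limits.kernelIsKernel f)
    have hex' := hex.map ((evaluation _ _).obj x)
    rw [ShortComplex.moduleCat_exact_iff] at hex'
    exact hex' m (piLift_app_eq_zero _ fun T =>
      (toLocalization_app_eq_zero_iff T.1 M x m).2 (hm T.1 T.2.1 T.2.2))

/-! ### Functoriality of local cohomology and of localization -/

theorem exists_zerothLocalCohomology_lift (S : Finset ι) {M N : PModule F ι} (γ : M ⟶ N) :
    ∃ η : zerothLocalCohomology S M ⟶ zerothLocalCohomology S N,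
      η ≫ zerothLocalCohomologyι S N = zerothLocalCohomologyι S M ≫ γ := by
  refine ⟨Limits.kernel.lift _ (zerothLocalCohomologyι S M ≫ γ) ?_, Limits.kernel.lift_ι _ _ _⟩
  refine NatTrans.ext (funext fun x => ModuleCat.hom_ext (LinearMap.ext fun h => ?_))
  refine piLift_app_eq_zero (x := x) _ fun T => ?_
  rw [toLocalization_app_eq_zero_iff]
  obtain ⟨y, hy, h0⟩ := (mem_range_zerothLocalCohomologyι S M x _).1 ⟨h, rfl⟩ T.1 T.2.1 T.2.2
  refine ⟨y, hy, ?_⟩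
  change N.map _ (γ.app x _) = 0
  rw [← naturality_map_apply]
  exact (congrArg (γ.app (x + y)) h0).trans (map_zero (γ.app (x + y)).hom)

/-- The induced map on `0`-th local cohomology. -/
def zerothLocalCohomologyMap (S : Finset ι) {M N : PModule F ι} (γ : M ⟶ N) :
    zerothLocalCohomology S M ⟶ zerothLocalCohomology S N :=
  (exists_zerothLocalCohomology_lift S γ).choose

theorem zerothLocalCohomologyMap_ι_apply (S : Finset ι) {M N : PModule F ι} (γ : M ⟶ N)
    (x : ι → ℝ) (h : (zerothLocalCohomology S M).obj x) :
    (zerothLocalCohomologyι S N).app x ((zerothLocalCohomologyMap S γ).app x h) =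
      γ.app x ((zerothLocalCohomologyι S M).app x h) :=
  congrArg (fun g : zerothLocalCohomology S M ⟶ N => g.app x h)
    (exists_zerothLocalCohomology_lift S γ).choose_spec

/-- The point is surjectivity: a preimage of a torsion element must itself be torsion. Its image
dies far along each face, and there injectivity of γ kills the preimage too. -/
theorem zerothLocalCohomologyMap_app_bijective (S : Finset ι) {M N : PModule F ι} (γ : M ⟶ N)
    (x : ι → ℝ) (hx : Function.Bijective (γ.app x))
    (hS : ∀ T : Finset ι, T.Nonempty → T ⊆ S → ∀ y ∈ face T, ∃ y' ∈ face T, y ≤ y' ∧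
      Function.Injective (γ.app (x + y'))) :
    Function.Bijective ((zerothLocalCohomologyMap S γ).app x) := by
  constructor
  · intro a b hab
    apply zerothLocalCohomologyι_app_injective S M x
    apply hx.1
    rw [← zerothLocalCohomologyMap_ι_apply, hab, zerothLocalCohomologyMap_ι_apply]
  · intro n
    obtain ⟨m, hm⟩ := hx.2 ((zerothLocalCohomologyι S N).app x n)
    obtain ⟨h, rfl⟩ := (mem_range_zerothLocalCohomologyι S M x m).2 fun T hT hTS => by
      obtain ⟨y, hy, h0⟩ := (mem_range_zerothLocalCohomologyι S N x _).1 ⟨n, rfl⟩ T hT hTS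
      obtain ⟨y', hy', hyy', hinj⟩ := hS T hT hTS y hy
      refine ⟨y', hy', hinj ?_⟩
      have hle : x + y ≤ x + y' := add_le_add_right hyy' x
      rw [naturality_map_apply, hm, ← map_map_apply N (le_add_of_mem_face hy x) hle, h0]
      exact (map_zero (N.map (homOfLE hle)).hom).trans (map_zero (γ.app (x + y')).hom).symm
    refine ⟨h, zerothLocalCohomologyι_app_injective S N x ?_⟩
    rw [zerothLocalCohomologyMap_ι_apply, hm]

/-- A map of filtered diagrams that is bijective on a cofinal set of indices induces an isomorphism
of colimits. -/
theorem localization_rank_eq (T : Finset ι) {A B : PModule F ι} (η : A ⟶ B) (x : ι → ℝ)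
    (h : ∀ y ∈ face T, ∃ y' ∈ face T, y ≤ y' ∧ Function.Bijective (η.app (x + y'))) :
    Module.rank F ((localization T A).obj x) = Module.rank F ((localization T B).obj x) := by
  let η' : faceDiagram T A x ⟶ faceDiagram T B x :=
    { app := fun y => η.app (x + y.1)
      naturality := fun _ _ _ => η.naturality _ }
  let f : Limits.colimit (faceDiagram T A x) ⟶ Limits.colimit (faceDiagram T B x) :=
    Limits.colimMap η'
  have hf : ∀ (y : face T) (a : A.obj (x + y.1)), f (Limits.colimit.ι (faceDiagram T A x) y a) =
      Limits.colimit.ι (faceDiagram T B x) y (η.app (x + y.1) a) := fun y a =>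
    congrArg (fun g : (faceDiagram T A x).obj y ⟶ _ => g a) (Limits.ι_colimMap η' y)
  have hw : ∀ (C : PModule F ι) (y y' : face T) (hyy' : y ≤ y') (a : C.obj (x + y.1)),
      Limits.colimit.ι (faceDiagram T C x) y' (C.map (homOfLE (add_le_add_right
        (show y.1 ≤ y'.1 from hyy') x)) a) = Limits.colimit.ι (faceDiagram T C x) y a :=
    fun C y y' hyy' a => congrArg (fun g : (faceDiagram T C x).obj y ⟶ _ => g a)
      (Limits.colimit.w (faceDiagram T C x) (homOfLE hyy'))
  have hbij : Function.Bijective f.hom := by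
    constructor
    · rw [← LinearMap.ker_eq_bot, LinearMap.ker_eq_bot']
      intro a ha
      obtain ⟨y, a, rfl⟩ := Limits.Concrete.colimit_exists_rep (faceDiagram T A x) a
      have ha' := (hf y a).symm.trans ha
      obtain ⟨z, hz, h0⟩ := (colimit_ι_eq_zero_iff T B x y _).1 ha'
      obtain ⟨z', hz', hzz', hb⟩ := h z.1 z.2
      refine (colimit_ι_eq_zero_iff T A x y a).2 ⟨⟨z', hz'⟩,
        hz.trans (add_le_add_right hzz' x), hb.1 ?_⟩
      rw [naturality_map_apply, ← map_map_apply B hz (add_le_add_right hzz' x), h0]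
      exact (map_zero (B.map (homOfLE _)).hom).trans (map_zero (η.app (x + z')).hom).symm
    · intro b
      obtain ⟨y, b, rfl⟩ := Limits.Concrete.colimit_exists_rep (faceDiagram T B x) b
      obtain ⟨z, hz, hyz, hb⟩ := h y.1 y.2
      obtain ⟨a, ha⟩ := hb.2 (B.map (homOfLE (add_le_add_right hyz x)) b)
      refine ⟨Limits.colimit.ι (faceDiagram T A x) ⟨z, hz⟩ a, (hf ⟨z, hz⟩ a).trans ?_⟩
      rw [ha]
      exact hw B y ⟨z, hz⟩ hyz b
  exact (LinearEquiv.ofBijective f.hom hbij).rank_eq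

/-! ### Points in general position -/

/-- Points whose coordinates avoid `D` and which have a coordinate larger than `R`. -/
def IsGeneric (D : Set ℝ) (R : ℝ) (x : ι → ℝ) : Prop :=
  (∀ i, x i ∉ D) ∧ ∃ i, R < x i

theorem exists_mem_face_isGeneric {D : Set ℝ} (hD : D.Finite) (R : ℝ) {T : Finset ι}
    (hT : T.Nonempty) {x y : ι → ℝ} (hy : y ∈ face T) (hx : ∀ i, i ∉ T → x i ∉ D) :
    ∃ y' ∈ face T, y ≤ y' ∧ IsGeneric D R (x + y') := by
  classical
  -- The lower bound `y i` gives `y ≤ y'`, and `R - x i` pushes the coordinate beyond `R`; only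
  -- finitely many `c` hit `D`.
  have h : ∀ i, ∃ c, max (y i) (R - x i) < c ∧ x i + c ∉ D := fun i => by
    have hfin : ((fun c => x i + c) ⁻¹' D).Finite := hD.preimage (add_right_injective _).injOn
    obtain ⟨c, hc, hc'⟩ := (Set.Ioi_infinite (max (y i) (R - x i))).exists_notMem_finite hfin
    exact ⟨c, hc, hc'⟩
  choose c hc hcD using h
  refine ⟨fun i => if i ∈ T then c i else 0, ⟨fun i => ?_, fun i hi => if_neg hi⟩,
    fun i => ?_, fun i => ?_, ?_⟩
  · dsimp only
    split
    · exact (hy.1 i).trans ((le_max_left _ _).trans (hc i).le)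
    · exact le_rfl
  · dsimp only
    split
    · exact (le_max_left _ _).trans (hc i).le
    · next hi => exact (hy.2 i hi).le
  · by_cases hi : i ∈ T
    · simpa [hi] using hcD i
    · simpa [hi] using hx i hi
  · obtain ⟨i, hi⟩ := hT
    refine ⟨i, ?_⟩
    have := (le_max_right _ _).trans_lt (hc i)
    simp only [Pi.add_apply, hi, if_true]
    linarith

theorem zerothLocalCohomologyMap_app_bijective_of_isGeneric (S : Finset ι) {M N : PModule F ι}
    (γ : M ⟶ N) {D : Set ℝ} (hD : D.Finite) {R : ℝ}
    (hγ : ∀ x, IsGeneric D R x → Function.Bijective (γ.app x)) {x : ι → ℝ}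
    (hx : IsGeneric D R x) : Function.Bijective ((zerothLocalCohomologyMap S γ).app x) := by
  refine zerothLocalCohomologyMap_app_bijective S γ x (hγ x hx) fun T hT _ y hy => ?_
  obtain ⟨y', hy', hyy', hg⟩ := exists_mem_face_isGeneric hD R hT hy fun i _ => hx.1 i
  exact ⟨y', hy', hyy', (hγ _ hg).1⟩

theorem hilbertFunction_quotientRestriction_eq [Fintype ι] [DecidableEq ι] {S : Finset ι}
    (hS : Sᶜ.Nonempty) {M N : PModule F ι} (γ : M ⟶ N) {D : Set ℝ} (hD : D.Finite) {R : ℝ}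
    (hγ : ∀ x, IsGeneric D R x → Function.Bijective (γ.app x)) (x : {i // i ∉ Sᶜ} → ℝ)
    (hx : ∀ i, x i ∉ D) :
    hilbertFunction (quotientRestriction Sᶜ (zerothLocalCohomology S M)) x =
      hilbertFunction (quotientRestriction Sᶜ (zerothLocalCohomology S N)) x := by
  unfold hilbertFunction
  congr 2
  refine localization_rank_eq Sᶜ (zerothLocalCohomologyMap S γ) (extendZero Sᶜ x) fun y hy => ?_
  -- The zero coordinates of `extendZero` may lie in `D`, but the move along the complementary face
  -- corrects exactly those.
  obtain ⟨y', hy', hyy', hg⟩ := exists_mem_face_isGeneric (x := extendZero Sᶜ x) hD R hS hy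
    fun i hi => by simpa only [extendZero, dif_pos hi] using hx ⟨i, hi⟩
  exact ⟨y', hy', hyy', zerothLocalCohomologyMap_app_bijective_of_isGeneric S γ hD hγ hg⟩

theorem ae_forall_notMem {κ : Type} [Fintype κ] {D : Set ℝ} (hD : D.Finite) :
    ∀ᵐ x ∂(lebesgue κ), ∀ i, (x : κ → ℝ) i ∉ D := by
  have h : ∀ᵐ x ∂(volume : Measure (κ → ℝ)), ∀ i, x i ∉ D := by
    rw [ae_all_iff]
    intro i
    exact (Measure.quasiMeasurePreserving_eval _ i).ae
      (measure_eq_zero_iff_ae_notMem.1 (hD.measure_zero volume))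
  exact h

/-! ### Cubes -/

theorem IsCube.inter {s t : Set (ι → ℝ)} (hs : IsCube s) (ht : IsCube t) : IsCube (s ∩ t) := by
  obtain ⟨I, hI, rfl⟩ := hs
  obtain ⟨J, hJ, rfl⟩ := ht
  exact ⟨fun i => I i ∩ J i, fun i => (hI i).inter (hJ i), Set.pi_inter_distrib.symm⟩

/-- Two points of a cube need not be comparable; their join lets properties pass from one to the
other. -/
theorem IsCube.sup_mem {s : Set (ι → ℝ)} (hs : IsCube s) {x y : ι → ℝ} (hx : x ∈ s)
    (hy : y ∈ s) : x ⊔ y ∈ s := by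
  obtain ⟨I, hI, rfl⟩ := hs
  intro i _
  rcases le_total (x i) (y i) with h | h
  · simpa [h] using hy i trivial
  · simpa [h] using hx i trivial

theorem IsCube.measurableSet [Fintype ι] {s : Set (ι → ℝ)} (hs : IsCube s) :
    MeasurableSet s := by
  obtain ⟨I, hI, rfl⟩ := hs
  exact MeasurableSet.univ_pi fun i => (hI i).measurableSet

theorem subsingleton_of_ordConnected_of_volume_eq_zero {I : Set ℝ} (hI : I.OrdConnected)
    (h : volume I = 0) : I.Subsingleton := by
  intro a ha b hb
  by_contra hab
  wlog hlt : a < b generalizing a b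
  · exact this hb ha (Ne.symm hab) (lt_of_le_of_ne (not_lt.1 hlt) (Ne.symm hab))
  have := measure_mono_null (hI.out ha hb) h
  rw [Real.volume_Icc, ENNReal.ofReal_eq_zero] at this
  linarith

theorem bddAbove_of_ordConnected_of_volume_ne_top {I : Set ℝ} (hI : I.OrdConnected)
    (h : volume I ≠ ∞) : BddAbove I := by
  by_contra hb
  rcases I.eq_empty_or_nonempty with rfl | ⟨a, ha⟩
  · exact hb bddAbove_empty
  refine h (top_le_iff.1 (Real.volume_Ici (a := a) ▸ measure_mono fun b hab => ?_))
  obtain ⟨c, hc, hbc⟩ := not_bddAbove_iff.1 hb b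
  exact hI.out ha hc ⟨hab, hbc.le⟩

/-- The volume is the product of the lengths. Either some factor is null, hence at most a point, and
serves as `D`; or no factor is null, so all are of finite length and bounded above, and `R` exceeds
the bounds. -/
theorem IsCube.exists_not_isGeneric [Fintype ι] {s : Set (ι → ℝ)} (hs : IsCube s)
    (h : volume s ≠ ∞) : ∃ (D : Set ℝ) (R : ℝ), D.Finite ∧ ∀ x ∈ s, ¬ IsGeneric D R x := by
  obtain ⟨I, hI, rfl⟩ := hs
  rw [volume_pi_pi] at h
  by_cases h0 : ∃ i, volume (I i) = 0
  · obtain ⟨i, hi⟩ := h0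
    refine ⟨I i, 0, (subsingleton_of_ordConnected_of_volume_eq_zero (hI i) hi).finite,
      fun x hx hg => hg.1 i (hx i trivial)⟩
  · push Not at h0
    have hb : ∀ i, BddAbove (I i) := fun i => by
      refine bddAbove_of_ordConnected_of_volume_ne_top (hI i) fun htop => h ?_
      classical
      rw [← Finset.mul_prod_erase _ _ (Finset.mem_univ i), htop]
      exact ENNReal.top_mul (Finset.prod_ne_zero_iff.2 fun j _ => h0 j)
    choose b hb using hb
    refine ⟨∅, ∑ i, |b i|, Set.finite_empty, fun x hx hg => ?_⟩
    obtain ⟨i, hi⟩ := hg.2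
    have h1 : x i ≤ b i := hb i (hx i trivial)
    have h2 : |b i| ≤ ∑ i, |b i| :=
      Finset.single_le_sum (f := fun i => |b i|) (fun j _ => abs_nonneg _) (Finset.mem_univ i)
    linarith [le_abs_self (b i)]

/-- A cube on which `P` fails has `f ≥ 1` throughout, so its volume is at most the integral of `f`,
and generic points avoid it. -/
theorem exists_forall_isGeneric [Fintype ι] {𝒬 : Set (Set (ι → ℝ))} (hfin : 𝒬.Finite)
    (hcube : ∀ Q ∈ 𝒬, IsCube Q) (hcover : ⋃₀ 𝒬 = Set.univ) (P : (ι → ℝ) → Prop)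
    (hP : ∀ Q ∈ 𝒬, ∀ x ∈ Q, ∀ y ∈ Q, P x → P y) (f : LebesgueSpace ι → ℝ≥0∞)
    (hf : ∀ x : ι → ℝ, ¬ P x → 1 ≤ f x) (hint : ∫⁻ x, f x ∂(lebesgue ι) ≠ ∞) :
    ∃ (D : Set ℝ) (R : ℝ), D.Finite ∧ ∀ x, IsGeneric D R x → P x := by
  have key : ∀ Q ∈ 𝒬, ∃ (D : Set ℝ) (R : ℝ), D.Finite ∧ ∀ x ∈ Q, IsGeneric D R x → P x := by
    intro Q hQ
    by_cases h : ∃ x ∈ Q, P x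
    · obtain ⟨x, hx, hPx⟩ := h
      exact ⟨∅, 0, Set.finite_empty, fun y hy _ => hP Q hQ x hx y hy hPx⟩
    · push Not at h
      have hm : @MeasurableSet (LebesgueSpace ι) _ Q :=
        (hcube Q hQ).measurableSet.nullMeasurableSet
      have hvol : volume Q ≠ ∞ := by
        refine ne_top_of_le_ne_top hint ?_
        calc volume Q = lebesgue ι Q := rfl
          _ = ∫⁻ x in (Q : Set (LebesgueSpace ι)), 1 ∂(lebesgue ι) :=
            (setLIntegral_one (α := LebesgueSpace ι) Q).symm
          _ ≤ ∫⁻ x in (Q : Set (LebesgueSpace ι)), f x ∂(lebesgue ι) :=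
            setLIntegral_mono' hm fun x hx => hf x (h x hx)
          _ ≤ _ := setLIntegral_le_lintegral _ _
      obtain ⟨D, R, hD, hR⟩ := (hcube Q hQ).exists_not_isGeneric hvol
      exact ⟨D, R, hD, fun x hx hg => (hR x hx hg).elim⟩
  choose! D R hD hR using key
  obtain ⟨R', hR'⟩ := (hfin.image R).bddAbove
  refine ⟨⋃ Q ∈ 𝒬, D Q, R', hfin.biUnion hD, fun x hx => ?_⟩
  obtain ⟨Q, hQ, hxQ⟩ := Set.mem_sUnion.1 (hcover.ge (Set.mem_univ x))
  refine hR Q hQ x hxQ ⟨fun i hi => hx.1 i (Set.mem_biUnion hQ hi), ?_⟩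
  obtain ⟨i, hi⟩ := hx.2
  exact ⟨i, (hR' (Set.mem_image_of_mem R hQ)).trans_lt hi⟩

/-! ### Morphisms of finite cost -/

theorem IsCubicallyEncoded.exists_cover {M : PModule F ι} (hM : IsCubicallyEncoded F ι M) :
    ∃ 𝒬 : Set (Set (ι → ℝ)), 𝒬.Finite ∧ (∀ Q ∈ 𝒬, IsCube Q) ∧ ⋃₀ 𝒬 = Set.univ ∧
      ∀ Q ∈ 𝒬, ∀ x ∈ Q, ∀ y ∈ Q, ∀ h : x ≤ y, IsIso (M.map (homOfLE h)) := by
  obtain ⟨Q, _, _, e, M', -, hcub, ⟨φ⟩⟩ := hM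
  choose 𝒮 hfin hcube hun using hcub
  refine ⟨⋃ q, 𝒮 q, Set.finite_iUnion hfin, fun s hs => ?_, ?_, fun s hs x hx y hy h => ?_⟩
  · obtain ⟨q, hq⟩ := Set.mem_iUnion.1 hs
    exact hcube q s hq
  · refine Set.eq_univ_of_forall fun x => ?_
    have hx : x ∈ ⋃₀ 𝒮 (e x) := hun (e x) ▸ rfl
    obtain ⟨s, hs, hxs⟩ := hx
    exact ⟨s, Set.mem_iUnion.2 ⟨_, hs⟩, hxs⟩
  · obtain ⟨q, hq⟩ := Set.mem_iUnion.1 hs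
    have hmem : ∀ z ∈ s, e z = q := fun z hz => by
      have : z ∈ e ⁻¹' {q} := hun q ▸ ⟨s, hq, hz⟩
      exact this
    -- Both points have the same code, so the arrow between the codes is invertible in `Q`.
    have hle : e y ≤ e x := by rw [hmem x hx, hmem y hy]
    rw [NatIso.isIso_map_iff φ]
    have : IsIso (e.monotone.functor.map (homOfLE h)) :=
      ⟨homOfLE hle, Subsingleton.elim _ _, Subsingleton.elim _ _⟩
    exact Functor.map_isIso M' _

theorem exists_common_cover {M N : PModule F ι} (hM : IsCubicallyEncoded F ι M)
    (hN : IsCubicallyEncoded F ι N) :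
    ∃ 𝒬 : Set (Set (ι → ℝ)), 𝒬.Finite ∧ (∀ Q ∈ 𝒬, IsCube Q) ∧ ⋃₀ 𝒬 = Set.univ ∧
      ∀ Q ∈ 𝒬, ∀ x ∈ Q, ∀ y ∈ Q, ∀ h : x ≤ y,
        IsIso (M.map (homOfLE h)) ∧ IsIso (N.map (homOfLE h)) := by
  obtain ⟨𝒜, hAf, hAc, hAu, hA⟩ := hM.exists_cover
  obtain ⟨ℬ, hBf, hBc, hBu, hB⟩ := hN.exists_cover
  refine ⟨Set.image2 (· ∩ ·) 𝒜 ℬ, hAf.image2 _ hBf, ?_, ?_, ?_⟩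
  · rintro _ ⟨a, ha, b, hb, rfl⟩
    exact (hAc a ha).inter (hBc b hb)
  · refine Set.eq_univ_of_forall fun x => ?_
    obtain ⟨a, ha, hxa⟩ := Set.mem_sUnion.1 (hAu.ge (Set.mem_univ x))
    obtain ⟨b, hb, hxb⟩ := Set.mem_sUnion.1 (hBu.ge (Set.mem_univ x))
    exact ⟨a ∩ b, ⟨a, ha, b, hb, rfl⟩, hxa, hxb⟩
  · rintro _ ⟨a, ha, b, hb, rfl⟩ x hx y hy h
    exact ⟨hA a ha x hx.1 y hy.1 h, hB b hb x hx.2 y hy.2 h⟩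

theorem one_le_hilbertFunction {M : PModule F ι} {x : ι → ℝ} (h : ¬ Limits.IsZero (M.obj x)) :
    1 ≤ hilbertFunction M x := by
  rw [ModuleCat.isZero_iff_subsingleton, not_subsingleton_iff_nontrivial] at h
  have h1 : (1 : Cardinal) ≤ Module.rank F (M.obj x) :=
    Cardinal.one_le_iff_pos.2 rank_pos
  exact ENat.toENNReal_one.ge.trans (ENat.toENNReal_le.2 <| Cardinal.one_le_toENat.2 h1)

theorem lintegral_hilbertFunction_rpow_ne_top [Fintype ι] {p : ℝ} (hp : 1 ≤ p)
    {μ : Measure (LebesgueSpace ι)} {M : PModule F ι} (h : hilbertAmplitude p μ M ≠ ∞) :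
    ∫⁻ x : LebesgueSpace ι, hilbertFunction M x ^ p ∂μ ≠ ∞ := by
  intro htop
  refine h ?_
  rw [hilbertAmplitude, htop]
  exact ENNReal.top_rpow_of_pos (by positivity)

/-- No encoding of the kernel or cokernel is needed: on a cube of the common cover the naturality
squares of γ have invertible vertical sides, so injectivity and surjectivity of `γ.app x` are
constant there. -/
theorem exists_isGeneric_bijective [Fintype ι] {M N : PModule F ι}
    (hM : IsCubicallyEncoded F ι M) (hN : IsCubicallyEncoded F ι N) (γ : M ⟶ N) {p : ℝ}
    (hp : 1 ≤ p) (h : morphismCost (hilbertAmplitude p (lebesgue ι)) γ ≠ ∞) :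
    ∃ (D : Set ℝ) (R : ℝ), D.Finite ∧
      ∀ x, IsGeneric D R x → Function.Bijective (γ.app x) := by
  obtain ⟨hk, hc⟩ := ENNReal.add_ne_top.1 h
  obtain ⟨𝒬, hf, hcube, hu, hQ⟩ := exists_common_cover hM hN
  have hmono : ∀ x, Limits.IsZero ((Limits.kernel γ).obj x) ↔ Mono (γ.app x) := fun x => by
    rw [Preadditive.mono_iff_isZero_kernel]
    exact (Limits.PreservesKernel.iso ((evaluation _ _).obj x) γ).isZero_iff
  have hepi : ∀ x, Limits.IsZero ((Limits.cokernel γ).obj x) ↔ Epi (γ.app x) := fun x => by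
    rw [Preadditive.epi_iff_isZero_cokernel]
    exact (Limits.PreservesCokernel.iso ((evaluation _ _).obj x) γ).isZero_iff
  have hiff : ∀ Q ∈ 𝒬, ∀ x ∈ Q, ∀ y ∈ Q, x ≤ y →
      (Mono (γ.app x) ↔ Mono (γ.app y)) ∧ (Epi (γ.app x) ↔ Epi (γ.app y)) := by
    intro Q hQm x hx y hy hxy
    obtain ⟨h₁, h₂⟩ := hQ Q hQm x hx y hy hxy
    have e : Arrow.mk (γ.app x) ≅ Arrow.mk (γ.app y) :=
      Arrow.isoMk (asIso (M.map (homOfLE hxy))) (asIso (N.map (homOfLE hxy)))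
        (γ.naturality (homOfLE hxy))
    exact ⟨(MorphismProperty.monomorphisms _).arrow_mk_iso_iff e,
      (MorphismProperty.epimorphisms _).arrow_mk_iso_iff e⟩
  have hone : ∀ (X : PModule F ι) (x : ι → ℝ), ¬ Limits.IsZero (X.obj x) →
      1 ≤ hilbertFunction X x ^ p := fun X x hX =>
    ENNReal.one_le_rpow (one_le_hilbertFunction hX) (by linarith)
  obtain ⟨D₁, R₁, hD₁, hR₁⟩ := exists_forall_isGeneric hf hcube hu (fun x => Mono (γ.app x))
    (fun Q hQm x hx y hy hm => by
      have hs := (hcube Q hQm).sup_mem hx hy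
      exact (hiff Q hQm y hy _ hs le_sup_right).1.2 ((hiff Q hQm x hx _ hs le_sup_left).1.1 hm))
    _ (fun x hx => hone _ x (mt (hmono x).1 hx)) (lintegral_hilbertFunction_rpow_ne_top hp hk)
  obtain ⟨D₂, R₂, hD₂, hR₂⟩ := exists_forall_isGeneric hf hcube hu (fun x => Epi (γ.app x))
    (fun Q hQm x hx y hy hm => by
      have hs := (hcube Q hQm).sup_mem hx hy
      exact (hiff Q hQm y hy _ hs le_sup_right).2.2 ((hiff Q hQm x hx _ hs le_sup_left).2.1 hm))
    _ (fun x hx => hone _ x (mt (hepi x).1 hx)) (lintegral_hilbertFunction_rpow_ne_top hp hc)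
  refine ⟨D₁ ∪ D₂, max R₁ R₂, hD₁.union hD₂, fun x hx => ⟨?_, ?_⟩⟩
  · obtain ⟨i, hi⟩ := hx.2
    exact (ModuleCat.mono_iff_injective _).1
      (hR₁ x ⟨fun i hi => hx.1 i (Or.inl hi), i, (le_max_left _ _).trans_lt hi⟩)
  · obtain ⟨i, hi⟩ := hx.2
    exact (ModuleCat.epi_iff_surjective _).1
      (hR₂ x ⟨fun i hi => hx.1 i (Or.inr hi), i, (le_max_right _ _).trans_lt hi⟩)

theorem cRank_eq_of_morphismCost_ne_top [Fintype ι] [DecidableEq ι] {S : Finset ι}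
    (hS : Sᶜ.Nonempty) {M N : CubMod F ι} (γ : M.obj ⟶ N.obj) {p : ℝ} (hp : 1 ≤ p)
    (h : morphismCost (hilbertAmplitude p (lebesgue ι)) γ ≠ ∞) : cRank S M = cRank S N := by
  obtain ⟨D, R, hD, hγ⟩ := exists_isGeneric_bijective M.property N.property γ hp h
  unfold cRank hilbertAmplitude
  congr 1
  refine lintegral_congr_ae ((ae_forall_notMem hD).mono fun x hx => ?_)
  exact congrArg (· ^ (1 : ℝ)) (hilbertFunction_quotientRestriction_eq hS γ hD hγ x hx)

theorem cRank_eq_of_cost_ne_top [Fintype ι] [DecidableEq ι] {S : Finset ι} (hS : Sᶜ.Nonempty)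
    {p : ℝ} (hp : 1 ≤ p) {M N : CubMod F ι} (z : Zigzag (IsCubicallyEncoded F ι) M N)
    (h : z.cost (hilbertAmplitude p (lebesgue ι)) ≠ ∞) : cRank S M = cRank S N := by
  induction z with
  | span X f g =>
    obtain ⟨hf, hg⟩ := ENNReal.add_ne_top.1 h
    exact (cRank_eq_of_morphismCost_ne_top hS f hp hf).symm.trans
      (cRank_eq_of_morphismCost_ne_top hS g hp hg)
  | cons X f g z ih =>
    obtain ⟨hfg, hz⟩ := ENNReal.add_ne_top.1 h
    obtain ⟨hf, hg⟩ := ENNReal.add_ne_top.1 hfg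
    exact ((cRank_eq_of_morphismCost_ne_top hS f hp hf).symm.trans
      (cRank_eq_of_morphismCost_ne_top hS g hp hg)).trans (ih hz)

theorem edist_cRank_le [Fintype ι] [DecidableEq ι] {S : Finset ι} (hS : Sᶜ.Nonempty) {p : ℝ}
    (hp : 1 ≤ p) {K : ℝ≥0} (hK : 0 < K) (M N : CubMod F ι) :
    edist (cRank S M) (cRank S N) ≤ K * (hilbertPathMetric F p hp (lebesgue ι)).edist M N := by
  change _ ≤ K * pathDist _ _ M N
  by_cases h : ∃ z : Zigzag (IsCubicallyEncoded F ι) M N,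
      z.cost (hilbertAmplitude p (lebesgue ι)) ≠ ∞
  · obtain ⟨z, hz⟩ := h
    rw [cRank_eq_of_cost_ne_top hS hp z hz, WeakPseudoEMetricSpace.edist_self]
    exact zero_le
  · push Not at h
    have htop : pathDist (IsCubicallyEncoded F ι) (hilbertAmplitude p (lebesgue ι)) M N = ∞ :=
      iInf_eq_top.2 h
    -- Positivity of `K` matters here, since `0 * ∞ = 0`.
    rw [htop, ENNReal.mul_top (ENNReal.coe_ne_zero.2 hK.ne')]
    exact le_top

/-! ### Interval modules -/

section IntervalModule

variable {Q : Type} [PartialOrder Q]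

/-- The fibre at `q` of the interval module with support `J` and value `V`, as a subspace of
`V`. -/
def intervalFibre (F : Type u) [Field F] (J : Set Q) (V : Type u) [AddCommGroup V] [Module F V]
    (q : Q) : Submodule F V where
  carrier := {m | q ∉ J → m = 0}
  zero_mem' _ := rfl
  add_mem' ha hb hq := by rw [ha hq, hb hq, add_zero]
  smul_mem' c m hm hq := by rw [hm hq, smul_zero]

open Classical in
/-- The structure maps of an interval module. -/
def intervalMap (F : Type u) [Field F] (J : Set Q) (V : Type u) [AddCommGroup V] [Module F V]
    (q q' : Q) : intervalFibre F J V q →ₗ[F] intervalFibre F J V q' where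
  toFun m := ⟨if q' ∈ J then m.1 else 0, fun h => if_neg h⟩
  map_add' a b := by ext; dsimp; split <;> simp
  map_smul' c a := by ext; dsimp; split <;> simp

/-- The module with value `V` on the convex set `J`, and zero elsewhere. -/
def intervalModule (F : Type u) [Field F] (J : Set Q) (hJ : J.OrdConnected) (V : Type u)
    [AddCommGroup V] [Module F V] : Q ⥤ ModuleCat.{u} F where
  obj q := ModuleCat.of F (intervalFibre F J V q)
  map {q q'} _ := ModuleCat.ofHom (intervalMap F J V q q')
  map_id q := by
    classical
    refine ModuleCat.hom_ext (LinearMap.ext fun m => Subtype.ext ?_)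
    change (if q ∈ J then m.1 else 0) = m.1
    split
    · rfl
    · next h => exact (m.2 h).symm
  map_comp {q q' q''} h h' := by
    classical
    refine ModuleCat.hom_ext (LinearMap.ext fun m => Subtype.ext ?_)
    change (if q'' ∈ J then m.1 else 0) = if q'' ∈ J then (if q' ∈ J then m.1 else 0) else 0
    by_cases h1 : q'' ∈ J
    · by_cases h2 : q' ∈ J
      · simp only [h2, if_true]
      -- Convexity enters here: a chain cannot leave `J` and return.
      · have : q ∉ J := fun h3 => h2 (hJ.out h3 h1 ⟨leOfHom h, leOfHom h'⟩)
        rw [show m.1 = 0 from m.2 this]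
        simp
    · simp only [h1, if_false]

end IntervalModule

/-- The monotone map `ℝ → {0, 1, 2}` jumping at `l` and at `r`. -/
def twoStep (l r t : ℝ) : Fin 3 := if t < l then 0 else if t < r then 1 else 2

theorem twoStep_mono (l r : ℝ) : Monotone (twoStep l r) := by
  intro s t h
  unfold twoStep
  split_ifs <;> first | decide | (exfalso; linarith)

theorem twoStep_eq_one_iff {l r t : ℝ} : twoStep l r t = 1 ↔ l ≤ t ∧ t < r := by
  unfold twoStep
  split_ifs with h₁ h₂
  · simp [h₁]
  · simp [not_lt.1 h₁, h₂]
  · simp [h₂]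

theorem one_le_twoStep_iff {l r t : ℝ} : 1 ≤ twoStep l r t ↔ l ≤ t := by
  unfold twoStep
  split_ifs with h₁ h₂
  · simp [h₁]
  · simp [not_lt.1 h₁]
  · exact iff_of_true (by decide) (not_lt.1 h₁)

/-! ### Box modules and a lower bound for their rank -/

section BoxModule

/-- The product of chains `{0, 1, 2}` that encodes boxes. -/
def BoxPoset (ι : Type) : Type := ι → Fin 3

instance : PartialOrder (BoxPoset ι) := inferInstanceAs (PartialOrder (ι → Fin 3))

instance [Finite ι] : Finite (BoxPoset ι) := inferInstanceAs (Finite (ι → Fin 3))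

/-- The product of the intervals `[0, a)` for `i ∈ S` and `[R, ∞)` for `i ∉ S`. -/
def box (S : Finset ι) (a R : ℝ) : Set (ι → ℝ) :=
  {x | (∀ i ∈ S, 0 ≤ x i ∧ x i < a) ∧ ∀ i ∉ S, R ≤ x i}

/-- The encoding map of the interval module on a box. -/
def boxEncoding [DecidableEq ι] (S : Finset ι) (a R : ℝ) : (ι → ℝ) →o BoxPoset ι where
  -- For `i ∉ S` the second jump at `a` is harmless, as `boxSupport` only requires a value at least
  -- 1.
  toFun x i := twoStep (if i ∈ S then 0 else R) a (x i)
  monotone' _ _ h i := twoStep_mono _ _ (h i)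

/-- The image of a box under its encoding map. -/
def boxSupport (S : Finset ι) : Set (BoxPoset ι) := {q | (∀ i ∈ S, q i = 1) ∧ ∀ i ∉ S, 1 ≤ q i}

theorem boxSupport_ordConnected (S : Finset ι) : (boxSupport S).OrdConnected :=
  ⟨fun _ hx _ hy _ hz => ⟨fun i hi => le_antisymm ((hz.2 i).trans (hy.1 i hi).le)
    ((hx.1 i hi).ge.trans (hz.1 i)), fun i hi => (hx.2 i hi).trans (hz.1 i)⟩⟩

variable [DecidableEq ι]

theorem boxEncoding_mem_iff {S : Finset ι} {a R : ℝ} {x : ι → ℝ} :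
    boxEncoding S a R x ∈ boxSupport S ↔ x ∈ box S a R := by
  refine and_congr (forall₂_congr fun i hi => ?_) (forall₂_congr fun i hi => ?_)
  · change twoStep _ _ _ = 1 ↔ _
    rw [twoStep_eq_one_iff, if_pos hi]
  · change 1 ≤ twoStep _ _ _ ↔ _
    rw [one_le_twoStep_iff, if_neg hi]

variable [Fintype ι]

/-- The interval module with value `V` on a box. -/
def boxModule (F : Type u) [Field F] (S : Finset ι) (a R : ℝ) (V : Type u) [AddCommGroup V]
    [Module F V] [Module.Finite F V] : CubMod F ι where
  obj := (boxEncoding S a R).monotone.functor ⋙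
    intervalModule F (boxSupport S) (boxSupport_ordConnected S) V
  property := ⟨BoxPoset ι, inferInstance, inferInstance, boxEncoding S a R,
    intervalModule F (boxSupport S) (boxSupport_ordConnected S) V,
    fun q => inferInstanceAs (Module.Finite F (intervalFibre F (boxSupport S) V q)),
    -- The encoding acts coordinatewise by monotone maps, so each fibre is a single cube.
    fun q => ⟨{boxEncoding S a R ⁻¹' {q}}, Set.finite_singleton _, by
      rintro _ rfl
      refine ⟨fun i => twoStep (if i ∈ S then 0 else R) a ⁻¹' {q i}, fun i =>
        Set.ordConnected_singleton.preimage_mono (twoStep_mono _ _), ?_⟩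
      ext x
      simp only [Set.mem_preimage, Set.mem_singleton_iff, Set.mem_univ_pi]
      exact funext_iff, (Set.sUnion_singleton _).symm⟩, ⟨Iso.refl _⟩⟩

variable {S : Finset ι} {a R : ℝ} {V : Type u} [AddCommGroup V] [Module F V]
  [Module.Finite F V]

/-- The embedding of a fibre of the interval module into `V`. -/
def boxModuleVal (S : Finset ι) (a R : ℝ) (V : Type u) [AddCommGroup V] [Module F V]
    [Module.Finite F V] (x : ι → ℝ) : (boxModule F S a R V).obj.obj x →ₗ[F] V :=
  (intervalFibre F (boxSupport S) V (boxEncoding S a R x)).subtype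

theorem boxModuleVal_injective (x : ι → ℝ) :
    Function.Injective (boxModuleVal (F := F) S a R V x) :=
  Subtype.val_injective

theorem boxModule_eq_zero {x : ι → ℝ} (hx : x ∉ box S a R)
    (m : (boxModule F S a R V).obj.obj x) : m = 0 :=
  Subtype.ext (m.2 (mt boxEncoding_mem_iff.1 hx))

theorem boxModuleVal_surjective {x : ι → ℝ} (hx : x ∈ box S a R) :
    Function.Surjective (boxModuleVal (F := F) S a R V x) :=
  fun m => ⟨⟨m, fun h => (h (boxEncoding_mem_iff.2 hx)).elim⟩, rfl⟩

theorem boxModuleVal_map {x y : ι → ℝ} (h : x ≤ y) (hy : y ∈ box S a R)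
    (m : (boxModule F S a R V).obj.obj x) :
    boxModuleVal S a R V y ((boxModule F S a R V).obj.map (homOfLE h) m) =
      boxModuleVal S a R V x m :=
  if_pos (boxEncoding_mem_iff.2 hy)

theorem boxModule_map_eq_zero {x y : ι → ℝ} (h : x ≤ y) (hxy : x ∈ box S a R → y ∉ box S a R) :
    (boxModule F S a R V).obj.map (homOfLE h) = 0 := by
  refine ModuleCat.hom_ext (LinearMap.ext fun m => ?_)
  by_cases hx : x ∈ box S a R
  · exact boxModule_eq_zero (hxy hx) _
  · rw [boxModule_eq_zero hx m]
    exact map_zero _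

theorem boxModule_isZero [Subsingleton V] : Limits.IsZero (boxModule F S a R V).obj :=
  Functor.isZero _ fun x =>
    have : Subsingleton ((boxModule F S a R V).obj.obj x) := (boxModuleVal_injective x).subsingleton
    ModuleCat.isZero_of_subsingleton _

theorem hilbertFunction_boxModule_le (x : ι → ℝ) :
    hilbertFunction (boxModule F S a R V).obj x ≤ ((Module.rank F V).toENat : ℝ≥0∞) :=
  ENat.toENNReal_le.2 (Cardinal.toENat.monotone'
    (LinearMap.rank_le_of_injective _ (boxModuleVal_injective x)))

theorem hilbertFunction_boxModule_eq_zero {x : ι → ℝ} (hx : x ∉ box S a R) :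
    hilbertFunction (boxModule F S a R V).obj x = 0 := by
  have : Subsingleton ((boxModule F S a R V).obj.obj x) :=
    ⟨fun m m' => by rw [boxModule_eq_zero hx m, boxModule_eq_zero hx m']⟩
  simp [hilbertFunction]

/-- A step of length `a` in any direction of τ leaves the box, so every element is torsion along
every nonzero face of τ. -/
theorem zerothLocalCohomologyι_boxModule_bijective (ha : 0 ≤ a) (x : ι → ℝ) :
    Function.Bijective
      ((zerothLocalCohomologyι S (boxModule F S a R V).obj).app x).hom := by
  refine ⟨zerothLocalCohomologyι_app_injective S _ x, fun m => ?_⟩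
  refine (mem_range_zerothLocalCohomologyι S _ x m).2 fun T hT hTS => ?_
  refine ⟨fun i => if i ∈ T then a else 0, ⟨fun i => ?_, fun i hi => if_neg hi⟩, ?_⟩
  · dsimp only; split <;> simp [ha]
  · rw [boxModule_map_eq_zero]
    · rfl
    · intro hx hy
      obtain ⟨i, hi⟩ := hT
      have h₁ := (hx.1 i (hTS hi)).1
      have h₂ := (hy.1 i (hTS hi)).2
      simp only [Pi.add_apply, hi, if_true] at h₂
      linarith

theorem extendZero_add_mem_box {x : {i // i ∉ Sᶜ} → ℝ} (hx : ∀ i, 0 ≤ x i ∧ x i < a)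
    {y : ι → ℝ} (hy : y ∈ face Sᶜ) (hyR : ∀ i ∉ S, R ≤ y i) :
    extendZero Sᶜ x + y ∈ box S a R := by
  refine ⟨fun i hi => ?_, fun i hi => ?_⟩
  · have hi' : i ∉ Sᶜ := by simpa using hi
    simpa only [Pi.add_apply, extendZero, dif_pos hi', hy.2 i hi', add_zero] using hx ⟨i, hi'⟩
  · have hi' : ¬ i ∉ Sᶜ := by simpa using hi
    simpa only [Pi.add_apply, extendZero, dif_neg hi', zero_add] using hyR i hi

/-- Once inside the box, moving along the complementary face stays inside, where the structure maps
are the identity of `V`; hence `V` embeds in the colimit. -/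
theorem le_hilbertFunction_quotientRestriction_boxModule (ha : 0 ≤ a) (hR : 0 ≤ R)
    {x : {i // i ∉ Sᶜ} → ℝ} (hx : ∀ i, 0 ≤ x i ∧ x i < a) :
    ((Module.rank F V).toENat : ℝ≥0∞) ≤ hilbertFunction
      (quotientRestriction Sᶜ (zerothLocalCohomology S (boxModule F S a R V).obj)) x := by
  refine ENat.toENNReal_le.2 (Cardinal.toENat.monotone' ?_)
  let M := (boxModule F S a R V).obj
  let z := extendZero Sᶜ x
  -- The smallest step that brings all coordinates outside `S` from 0 to `R`.
  let y₀ : face Sᶜ := ⟨fun i => if i ∈ S then 0 else R, fun i => by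
    dsimp only; split <;> simp [hR], fun i hi => if_pos (by simpa using hi)⟩
  have hy₀ : z + y₀.1 ∈ box S a R :=
    extendZero_add_mem_box hx y₀.2 fun i hi => (if_neg hi).ge
  let e₁ := LinearEquiv.ofBijective _
    (zerothLocalCohomologyι_boxModule_bijective (F := F) (S := S) (R := R) (V := V) ha (z + y₀.1))
  let e₂ := LinearEquiv.ofBijective (boxModuleVal (F := F) S a R V (z + y₀.1))
    ⟨boxModuleVal_injective _, boxModuleVal_surjective hy₀⟩
  let j := (Limits.colimit.ι (faceDiagram Sᶜ (zerothLocalCohomology S M) z) y₀).hom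
  have hj : Function.Injective j := by
    rw [← LinearMap.ker_eq_bot, LinearMap.ker_eq_bot']
    intro m hm
    obtain ⟨y, h, h0⟩ := (colimit_ι_eq_zero_iff Sᶜ (zerothLocalCohomology S M) z y₀ m).1 hm
    apply zerothLocalCohomologyι_app_injective S M (z + y₀.1)
    apply boxModuleVal_injective (z + y₀.1)
    have hy : z + y.1 ∈ box S a R := extendZero_add_mem_box hx y.2 fun i hi =>
      (if_neg hi).ge.trans (le_of_add_le_add_left h i)
    rw [← boxModuleVal_map h hy]
    have h1 := naturality_map_apply (zerothLocalCohomologyι S M) h m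
    rw [h0] at h1
    refine (congrArg (boxModuleVal S a R V (z + y.1)) h1.symm).trans ?_
    rw [show (zerothLocalCohomologyι S M).app (z + y.1) 0 = 0 from
      map_zero ((zerothLocalCohomologyι S M).app (z + y.1)).hom,
      show (zerothLocalCohomologyι S M).app (z + y₀.1) 0 = 0 from
      map_zero ((zerothLocalCohomologyι S M).app (z + y₀.1)).hom]
    exact (map_zero _).trans (map_zero _).symm
  exact (e₁.trans e₂).rank_eq.symm.le.trans (LinearMap.rank_le_of_injective j hj)

theorem le_cRank_boxModule (ha : 0 ≤ a) (hR : 0 ≤ R) :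
    ((Module.rank F V).toENat : ℝ≥0∞) *
      ENNReal.ofReal a ^ Fintype.card {i // i ∉ Sᶜ} ≤ cRank S (boxModule F S a R V) := by
  let I : Set (LebesgueSpace {i // i ∉ Sᶜ}) := Set.univ.pi fun _ => Set.Ico 0 a
  have hI : MeasurableSet I :=
    (MeasurableSet.univ_pi fun _ => measurableSet_Ico :
      MeasurableSet (Set.univ.pi fun _ : {i // i ∉ Sᶜ} => Set.Ico 0 a)).nullMeasurableSet
  have hvol : lebesgue _ I = ENNReal.ofReal a ^ Fintype.card {i // i ∉ Sᶜ} := by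
    change volume (Set.univ.pi fun _ : {i // i ∉ Sᶜ} => Set.Ico 0 a) = _
    rw [volume_pi_pi]
    simp
  rw [cRank, hilbertAmplitude, div_one, ENNReal.rpow_one, ← hvol, ← setLIntegral_const]
  refine (setLIntegral_mono' hI fun x hx => ?_).trans (setLIntegral_le_lintegral I _)
  rw [ENNReal.rpow_one]
  exact le_hilbertFunction_quotientRestriction_boxModule ha hR fun i => hx i trivial

end BoxModule

/-! ### Discontinuity -/

theorem isZero_localization (T : Finset ι) {M : PModule F ι} (hM : Limits.IsZero M) (x : ι → ℝ) :
    Limits.IsZero ((localization T M).obj x) := by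
  have h : ∀ m : (localization T M).obj x, m = 0 := fun m => by
    obtain ⟨y, m, rfl⟩ := Limits.Concrete.colimit_exists_rep (faceDiagram T M x) m
    have := ModuleCat.subsingleton_of_isZero (hM.obj (x + y.1))
    rw [Subsingleton.elim m 0]
    exact map_zero (Limits.colimit.ι (faceDiagram T M x) y).hom
  have : Subsingleton ((localization T M).obj x) := ⟨fun a b => (h a).trans (h b).symm⟩
  exact ModuleCat.isZero_of_subsingleton _

theorem cRank_eq_zero_of_isZero [Fintype ι] [DecidableEq ι] (S : Finset ι) {M : CubMod F ι}
    (hM : Limits.IsZero M.obj) : cRank S M = 0 :=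
  hilbertAmplitude_of_isZero le_rfl _ _ (Functor.isZero _ fun _ =>
    isZero_localization _ (hM.of_mono (zerothLocalCohomologyι S M.obj)) _)

/-- Continuity fails at the zero module, where the rank is 0. -/
theorem not_continuous_cRank [Fintype ι] [DecidableEq ι] (S : Finset ι)
    (d : PseudoEMetricSpace (CubMod F ι))
    (h : ∀ Z : CubMod F ι, Limits.IsZero Z.obj → ∀ δ : ℝ≥0∞, 0 < δ →
      ∃ M, d.edist M Z < δ ∧ 1 ≤ cRank S M) :
    ¬ @Continuous (CubMod F ι) ℝ≥0∞ d.toUniformSpace.toTopologicalSpace _ (cRank S) := by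
  intro hc
  let Z : CubMod F ι := boxModule F S 0 0 PUnit
  have hZ : Limits.IsZero Z.obj := boxModule_isZero
  have hlt : cRank S Z < 1 := by simp [cRank_eq_zero_of_isZero S hZ]
  have hev := hc.continuousAt.eventually (Iio_mem_nhds hlt)
  obtain ⟨δ, hδ, hball⟩ := EMetric.mem_nhds_iff.1 hev
  obtain ⟨M, hM, hM'⟩ := h Z hZ δ hδ
  exact (hball (show M ∈ Metric.eball Z δ from hM)).not_ge hM'

/-- Zero morphisms suffice: the shift by twice `ε v` exceeds the side `ε v i` of the box in
direction `i`, so the structure map vanishes. -/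
theorem isInterleaved_boxModule [Fintype ι] [DecidableEq ι] {S : Finset ι} {v : ι → ℝ≥0}
    {ε : ℝ≥0} {i : ι} (hi : i ∈ S) {R : ℝ} {V : Type u} [AddCommGroup V] [Module F V]
    [Module.Finite F V] {Z : PModule F ι} (hZ : Limits.IsZero Z) :
    IsInterleaved v ε (boxModule F S (ε * v i) R V).obj Z := by
  refine ⟨0, 0, fun x => ?_, fun x => (hZ.obj x).eq_of_src _ _⟩
  rw [boxModule_map_eq_zero]
  · exact Limits.zero_comp
  · intro hx hx'
    have h₁ := (hx.1 i hi).1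
    have h₂ := (hx'.1 i hi).2
    simp only [Pi.add_apply, scaled, NNReal.coe_mul] at h₂
    have : (0 : ℝ) ≤ ε * v i := by positivity
    linarith

theorem not_continuous_cRank_interleavingMetric [Fintype ι] [DecidableEq ι] {S : Finset ι}
    (hS : S.Nonempty) (v : ι → ℝ≥0) (hv : ∀ i, 0 < v i) :
    ¬ @Continuous (CubMod F ι) ℝ≥0∞
      (interleavingMetric F v).toUniformSpace.toTopologicalSpace _ (cRank S) := by
  refine not_continuous_cRank S _ fun Z hZ δ hδ => ?_
  obtain ⟨i, hi⟩ := hS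
  obtain ⟨ε, hε, hεδ⟩ := ENNReal.lt_iff_exists_nnreal_btwn.1 hδ
  have hε0 : 0 < ε := by exact_mod_cast hε
  have ha : (0 : ℝ) < ε * v i := mul_pos hε0 (hv i)
  have ha' : ENNReal.ofReal (ε * v i) ^ Fintype.card {i // i ∉ Sᶜ} ≠ 0 :=
    pow_ne_zero _ (ENNReal.ofReal_pos.2 ha).ne'
  -- The dimension `k` does not affect the interleaving, so it can compensate for the small volume
  -- of the box.
  obtain ⟨k, hk⟩ := ENNReal.exists_nat_mul_gt ha' ENNReal.one_ne_top
  refine ⟨boxModule F S (ε * v i) 0 (Fin k → F), lt_of_le_of_lt ?_ hεδ,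
    le_trans ?_ (le_cRank_boxModule ha.le le_rfl)⟩
  · exact iInf₂_le ε ⟨hε0, isInterleaved_boxModule hi hZ⟩
  · rw [rank_fin_fun]
    simpa using hk.le

/-- The zigzag `M ← M → Z`, identity and zero map, costs only the kernel of the zero map, which is
`M` up to isomorphism. -/
theorem pathDist_le_of_isZero [Fintype ι] {p : ℝ} (hp : 1 ≤ p) (μ : Measure (LebesgueSpace ι))
    (M : CubMod F ι) {Z : CubMod F ι} (hZ : Limits.IsZero Z.obj) :
    (hilbertPathMetric F p hp μ).edist M Z ≤ hilbertAmplitude p μ M.obj := by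
  let α := hilbertAmplitude (F := F) p μ
  have hα := hilbertAmplitude_of_isZero (F := F) hp μ
  have hiso : ∀ {A B : PModule F ι}, (A ≅ B) → α A = α B := fun {A B} e => by
    have h : hilbertFunction A = hilbertFunction B := funext fun x => by
      unfold hilbertFunction
      rw [(e.app x).toLinearEquiv.rank_eq]
    simp only [α, hilbertAmplitude, h]
  refine (iInf_le (fun z : Zigzag (IsCubicallyEncoded F ι) M Z => z.cost α)
    (.span M (𝟙 _) 0)).trans ?_
  have h₁ : α (Limits.kernel (𝟙 M.obj)) = 0 := hα _ (Limits.isZero_kernel_of_mono _)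
  have h₁' : α (Limits.cokernel (𝟙 M.obj)) = 0 := hα _ (Limits.isZero_cokernel_of_epi _)
  have h₂ : α (Limits.cokernel (0 : M.obj ⟶ Z.obj)) = 0 :=
    hα _ (hZ.of_epi (Limits.cokernel.π _))
  simp only [Zigzag.cost, morphismCost, h₁, h₁', h₂, zero_add, add_zero]
  exact (hiso Limits.kernelZeroIsoSource).le

/-- Continuity from above, which needs finiteness of μ; Lebesgue measure of these half-spaces is
infinite. -/
theorem tendsto_measure_halfspace [Fintype ι] (μ : Measure (LebesgueSpace ι)) [IsFiniteMeasure μ]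
    (j : ι) :
    Filter.Tendsto (fun k : ℕ => μ {x | (k : ℝ) ≤ (x : ι → ℝ) j}) Filter.atTop (nhds 0) := by
  have hm : ∀ k : ℕ, MeasurableSet {x : LebesgueSpace ι | (k : ℝ) ≤ (x : ι → ℝ) j} := fun k =>
    (measurableSet_le measurable_const (measurable_pi_apply j) :
      MeasurableSet {x : ι → ℝ | (k : ℝ) ≤ x j}).nullMeasurableSet
  have h := tendsto_measure_iInter_atTop (μ := μ) (fun k => (hm k).nullMeasurableSet)
    (fun k l hkl x (hx : (l : ℝ) ≤ (x : ι → ℝ) j) => show (k : ℝ) ≤ (x : ι → ℝ) j from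
      (Nat.cast_le.2 hkl).trans hx) ⟨0, measure_ne_top _ _⟩
  have he : ⋂ k : ℕ, {x : LebesgueSpace ι | (k : ℝ) ≤ (x : ι → ℝ) j} = ∅ := by
    refine Set.eq_empty_of_forall_notMem fun x hx => ?_
    obtain ⟨k, hk⟩ := exists_nat_gt ((x : ι → ℝ) j)
    exact (not_le.2 hk) (Set.mem_iInter.1 hx k)
  rwa [he, measure_empty] at h

theorem hilbertAmplitude_boxModule_le [Fintype ι] [DecidableEq ι] {p : ℝ} (hp : 1 ≤ p)
    (μ : Measure (LebesgueSpace ι)) {S : Finset ι} {j : ι} (hj : j ∉ S) (a R : ℝ) :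
    hilbertAmplitude p μ (boxModule F S a R (Fin 1 → F)).obj ≤
      μ {x | R ≤ (x : ι → ℝ) j} ^ (1 / p) := by
  have hp0 : 0 < p := by linarith
  refine ENNReal.rpow_le_rpow ?_ (by positivity)
  refine le_trans (lintegral_mono fun x => ?_)
    (lintegral_indicator_one_le {x : LebesgueSpace ι | R ≤ (x : ι → ℝ) j})
  by_cases hx : (x : ι → ℝ) ∈ box S a R
  · have hx' : x ∈ {x : LebesgueSpace ι | R ≤ (x : ι → ℝ) j} := hx.2 j hj
    rw [Set.indicator_of_mem hx', Pi.one_apply]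
    refine ENNReal.rpow_le_one ((hilbertFunction_boxModule_le (ι := ι) x).trans ?_) hp0.le
    rw [rank_fin_fun]
    simp
  · rw [hilbertFunction_boxModule_eq_zero hx, ENNReal.zero_rpow_of_pos hp0]
    exact zero_le

theorem not_continuous_cRank_hilbertPathMetric [Fintype ι] [DecidableEq ι] {S : Finset ι}
    (hS : Sᶜ.Nonempty) {p : ℝ} (hp : 1 ≤ p) (μ : Measure (LebesgueSpace ι)) [IsFiniteMeasure μ] :
    ¬ @Continuous (CubMod F ι) ℝ≥0∞
      (hilbertPathMetric F p hp μ).toUniformSpace.toTopologicalSpace _ (cRank S) := by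
  refine not_continuous_cRank S _ fun Z hZ δ hδ => ?_
  obtain ⟨j, hj⟩ := hS
  have hp0 : 0 < 1 / p := one_div_pos.2 (zero_lt_one.trans_le hp)
  have ht : Filter.Tendsto (fun k : ℕ => μ {x | (k : ℝ) ≤ (x : ι → ℝ) j} ^ (1 / p))
      Filter.atTop (nhds 0) := by
    have := (tendsto_measure_halfspace μ j).ennrpow_const (1 / p)
    rwa [ENNReal.zero_rpow_of_pos hp0] at this
  obtain ⟨k, hk⟩ := (ht.eventually (Iio_mem_nhds hδ)).exists
  -- With side 1 and dimension 1 the rank is at least 1 however far out the box starts.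
  refine ⟨boxModule F S 1 k (Fin 1 → F), lt_of_le_of_lt ((pathDist_le_of_isZero hp μ _ hZ).trans
    (hilbertAmplitude_boxModule_le hp μ (Finset.mem_compl.1 hj) 1 k)) hk,
    le_trans ?_ (le_cRank_boxModule zero_le_one k.cast_nonneg)⟩
  rw [rank_fin_fun]
  simp

end

end CtauRank

open CategoryTheory MeasureTheory CtauRank
open scoped NNReal ENNReal

theorem mainTheorem10 {F : Type*} [Field F] (n : ℕ) (S : Finset (Fin n))
    (hS : 1 ≤ S.card) (hSn : S.card < n) :
    (∀ v : Fin n → ℝ≥0, (∀ i, 0 < v i) →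
      ¬ @Continuous (CubMod F (Fin n)) ℝ≥0∞
        (interleavingMetric F v).toUniformSpace.toTopologicalSpace _ (cRank S)) ∧
    (∀ (p : ℝ) (hp : 1 ≤ p) (μ : Measure (LebesgueSpace (Fin n))), IsFiniteMeasure μ → μ ≠ 0 →
      ¬ @Continuous (CubMod F (Fin n)) ℝ≥0∞
        (hilbertPathMetric F p hp μ).toUniformSpace.toTopologicalSpace _ (cRank S)) ∧
    (∀ (p : ℝ) (hp : 1 ≤ p) (K : ℝ≥0), 0 < K → ∀ M N : CubMod F (Fin n),
      edist (cRank S M) (cRank S N) ≤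
        K * (hilbertPathMetric F p hp (lebesgue (Fin n))).edist M N) := by
  have hS' : S.Nonempty := Finset.card_pos.1 hS
  have hSc : Sᶜ.Nonempty := by
    rw [← Finset.card_pos, Finset.card_compl, Fintype.card_fin]
    omega
  exact ⟨fun v hv => not_continuous_cRank_interleavingMetric hS' v hv,
    fun p hp μ _ _ => not_continuous_cRank_hilbertPathMetric hSc hp μ,
    fun p hp K hK M N => edist_cRank_le hSc hp hK M N⟩
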